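/- Let $\varepsilon_1,\varepsilon_2,\dots$ be i.i.d. real random variables with mean $0$, variance $\sigma^2>0$ and $\mathrm E(\varepsilon_1^6)<\infty$, and put $\gamma_4=\mathrm E(\varepsilon_1^4)/\sigma^4$ (so $\gamma_4\ge 1$). Let $g:[0,1]\to\mathbb R$ be twice differentiable with bounded second derivative, and for each $n$ observe $y_i=g(i/n)+\varepsilon_i$, $i=1,\dots,n$. For $1\le k\le m<n$ let $$s_k=\frac1{2(n-k)}\sum_{i=1}^{n-k}(y_{i+k}-y_i)^2,\qquad d_k=\frac{k^2}{n^2},\qquad N=\sum_{k=1}^m (n-k),\qquad w_k=\frac{n-k}{N},\qquad \bar d_w=\sum_{k=1}^m w_kd_k,$$ and let the least squares estimator of $\sigma^2$ be the intercept of the regression of $s_k$ on $d_k$ with weights $w_k$, $$\hat\sigma^2=\sum_{k=1}^m w_ks_k-\hat\beta_1\bar d_w,\qquad \hat\beta_1=\frac{\sum_{k=1}^m w_ks_k(d_k-\bar d_w)}{\sum_{k=1}^m w_k(d_k-\bar d_w)^2}.$$ Let $0<r<1/2$ and let $m=m_n$ be positive integers with $m_n/n^r\to1$ (for example $m_n=\lfloor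 n^r\rfloor$). Then, as $n\to\infty$, $$\sqrt n\,(\hat\sigma^2-\sigma^2)\ \xrightarrow{\ \mathcal D\ }\ N\bigl(0,(\gamma_4-1)\sigma^4\bigr),$$ where $N(0,0)$ denotes the point mass at $0$. The sample variance $S_n^2=\frac1{n-1}\sum_{i=1}^n(\varepsilon_i-\bar\varepsilon_n)^2$, $\bar\varepsilon_n=\frac1n\sum_{i=1}^n\varepsilon_i$, of the errors themselves has the same limit, $\sqrt n\,(S_n^2-\sigma^2)\xrightarrow{\mathcal D}N(0,(\gamma_4-1)\sigma^4)$, so $\hat\sigma^2$ is asymptotically as efficient as the sample variance of the i.i.d. errors. -/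

import Mathlib

open MeasureTheory ProbabilityTheory Filter Topology Set

noncomputable section

namespace LagRegression

/-- `g` is twice differentiable on `[0, 1]` (one-sided at the end points), with a bounded
second derivative. -/
def HasBoundedSecondDeriv (g : ℝ → ℝ) : Prop :=
  DifferentiableOn ℝ g (Icc 0 1) ∧
  DifferentiableOn ℝ (derivWithin g (Icc 0 1)) (Icc 0 1) ∧
  ∃ C : ℝ, ∀ x ∈ Icc (0 : ℝ) 1, |derivWithin (derivWithin g (Icc 0 1)) (Icc 0 1) x| ≤ C

/-- The `n` observations `y_1, …, y_n` for the equally spaced design `x_i = i / n`. Indices start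
at `0`: `obs g e n i` is the observation `y_{i+1} = g ((i + 1) / n) + ε_{i+1}`, where `e i` stands
for `ε_{i+1}`; it is used only for `i < n`. -/
def obs (g : ℝ → ℝ) (e : ℕ → ℝ) (n i : ℕ) : ℝ :=
  g (((i : ℝ) + 1) / n) + e i

/-- The lag-`k` Rice estimator `s_k` computed from `n` observations `y 0, …, y (n - 1)`. -/
def lagRice (y : ℕ → ℝ) (n k : ℕ) : ℝ :=
  1 / (2 * ((n : ℝ) - k)) * ∑ i ∈ Finset.range (n - k), (y (i + k) - y i) ^ 2

/-- The regressor `d_k = k² / n²`. -/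
def regressor (n k : ℕ) : ℝ := (k : ℝ) ^ 2 / (n : ℝ) ^ 2

/-- The number of pairs `N = (n - 1) + (n - 2) + ⋯ + (n - m)`. -/
def numPairs (n m : ℕ) : ℝ := ∑ k ∈ Finset.Icc 1 m, ((n : ℝ) - k)

/-- The weight `w_k = (n - k) / N`. -/
def weight (n m k : ℕ) : ℝ := ((n : ℝ) - k) / numPairs n m

/-- The weighted mean of the regressors, `∑ w_k d_k`. -/
def regressorMean (n m : ℕ) : ℝ := ∑ k ∈ Finset.Icc 1 m, weight n m k * regressor n k

/-- The weighted least squares slope in the regression of `s_k` on `d_k`, `k = 1, …, m`. -/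
def slope (y : ℕ → ℝ) (n m : ℕ) : ℝ :=
  (∑ k ∈ Finset.Icc 1 m, weight n m k * lagRice y n k * (regressor n k - regressorMean n m)) /
    ∑ k ∈ Finset.Icc 1 m, weight n m k * (regressor n k - regressorMean n m) ^ 2

/-- The least squares estimator of the error variance: the weighted least squares intercept in
the regression of `s_k` on `d_k`, `k = 1, …, m`. -/
def lsEstimator (y : ℕ → ℝ) (n m : ℕ) : ℝ :=
  (∑ k ∈ Finset.Icc 1 m, weight n m k * lagRice y n k) - slope y n m * regressorMean n m

/-- The sample variance of `e 0, …, e (n - 1)`. -/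
def sampleVariance (e : ℕ → ℝ) (n : ℕ) : ℝ :=
  1 / ((n : ℝ) - 1) *
    ∑ i ∈ Finset.range n, (e i - (∑ j ∈ Finset.range n, e j) / n) ^ 2

/-- `γ₄ = E(X⁴) / σ⁴`, where `σ` is the standard deviation of the centred variable `X`. -/
def gamma4 {Ω : Type*} [MeasurableSpace Ω] (P : Measure Ω) (X : Ω → ℝ) (σ : ℝ) : ℝ :=
  (∫ ω, X ω ^ 4 ∂P) / σ ^ 4

end LagRegression

end

/-!
The weighted least squares intercept is a weighted sum of squared differences,
`(2 N)⁻¹ ∑_k b_k ∑_i (y_{i+k} - y_i)²`, where the multipliers `b_k` are bounded uniformly in `n`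
(`abs_interceptCoef_le`) and `∑_k b_k (n - k) = N` (`sum_interceptCoef_mul`). The bound on `b_k`
comes from `∑_{k ≤ m} (k² - c)²` being of order `m⁵` for every `c`.

Expanding the squares (`lsEstimator_sub_mean_sq`), every `ε_i²` away from the two ends is counted
with the same total weight, so the error of the estimator is `n⁻¹ ∑ (ε_i² - σ²)` up to

* a bias of order `(m / n)²`, a term linear in the errors of order `m / n`, and boundary terms of
  order `m / n`, all bounded by the triangle inequality in mean, as `g` is Lipschitz;
* the average of the products `b_k ε_i ε_{i+k}` over the `N` pairs. The products are uncorrelated,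
  so it has order `N⁻¹ᐟ²`, that is `(n m)⁻¹ᐟ²` (`meanAbsLe_crossTerm`).

After multiplication by `√n` these are `O(m / √n + 1 / √m)` in mean, which vanishes because
`m ∼ n ^ r` with `0 < r < 1 / 2`. The sample variance differs from `σ² + n⁻¹ ∑ (ε_i² - σ²)` by
`O(1 / n)` in mean. Both limits then follow from the central limit theorem for the `ε_i²`, whose
variance is `(γ₄ - 1) σ⁴`, and Slutsky's theorem. The degenerate case `γ₄ = 1` needs no separate
treatment, as the central limit theorem allows variance `0`.
-/

namespace LagRegression

/-! ### Least squares weights -/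

/-- The multiplier `b_k` such that the regression intercept is `∑ b_k w_k s_k`. -/
noncomputable def interceptCoef (n m k : ℕ) : ℝ :=
  1 - regressorMean n m * (regressor n k - regressorMean n m) /
    ∑ j ∈ Finset.Icc 1 m, weight n m j * (regressor n j - regressorMean n m) ^ 2

lemma lsEstimator_eq_sum_interceptCoef (y : ℕ → ℝ) (n m : ℕ) :
    lsEstimator y n m =
      ∑ k ∈ Finset.Icc 1 m, interceptCoef n m k * (weight n m k * lagRice y n k) := by
  unfold lsEstimator slope interceptCoef
  rw [div_mul_eq_mul_div, Finset.sum_mul, Finset.sum_div, ← Finset.sum_sub_distrib]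
  refine Finset.sum_congr rfl fun k _ => ?_
  ring

lemma weight_mul_lagRice (y : ℕ → ℝ) {n m k : ℕ} (hk : k < n) :
    weight n m k * lagRice y n k =
      (2 * numPairs n m)⁻¹ * ∑ i ∈ Finset.range (n - k), (y (i + k) - y i) ^ 2 := by
  have h : (n : ℝ) - k ≠ 0 := by
    have : (k : ℝ) < n := by exact_mod_cast hk
    linarith
  unfold weight lagRice
  field_simp

lemma numPairs_ge {n m : ℕ} (h : 2 * m ≤ n) : (n : ℝ) * m / 2 ≤ numPairs n m := by
  have h1 : ∑ _k ∈ Finset.Icc 1 m, ((n : ℝ) / 2) ≤ numPairs n m := by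
    refine Finset.sum_le_sum fun k hk => ?_
    have h2 : (2 * k : ℝ) ≤ n := by
      have := (Finset.mem_Icc.1 hk).2
      exact_mod_cast (by omega : 2 * k ≤ n)
    linarith
  simp only [Finset.sum_const, Nat.card_Icc, nsmul_eq_mul, Nat.add_sub_cancel] at h1
  linarith

lemma numPairs_le (n m : ℕ) : numPairs n m ≤ n * m := by
  have h1 : numPairs n m ≤ ∑ _k ∈ Finset.Icc 1 m, (n : ℝ) :=
    Finset.sum_le_sum fun k _ => by have := k.cast_nonneg (α := ℝ); linarith
  simp only [Finset.sum_const, Nat.card_Icc, nsmul_eq_mul, Nat.add_sub_cancel] at h1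
  linarith

lemma numPairs_pos {n m : ℕ} (hm : 0 < m) (h : 2 * m ≤ n) : 0 < numPairs n m := by
  have h1 := numPairs_ge h
  have hm' : (0 : ℝ) < m := by exact_mod_cast hm
  have hn' : (0 : ℝ) < n := by exact_mod_cast (by omega : 0 < n)
  have : 0 < (n : ℝ) * m / 2 := by positivity
  linarith

lemma sum_weight {n m : ℕ} (hm : 0 < m) (h : 2 * m ≤ n) :
    ∑ k ∈ Finset.Icc 1 m, weight n m k = 1 := by
  unfold weight
  rw [← Finset.sum_div]
  exact div_self (numPairs_pos hm h).ne'

lemma weight_ge {n m k : ℕ} (hm : 0 < m) (h : 2 * m ≤ n) (hk : k ≤ m) :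
    1 / (2 * (m : ℝ)) ≤ weight n m k := by
  have hm' : (0 : ℝ) < m := by exact_mod_cast hm
  have hN := numPairs_pos hm h
  have hk' : (2 * k : ℝ) ≤ n := by exact_mod_cast (by omega : 2 * k ≤ n)
  unfold weight
  rw [div_le_div_iff₀ (by positivity) hN]
  have := numPairs_le n m
  nlinarith

lemma weight_nonneg {n m k : ℕ} (hm : 0 < m) (h : 2 * m ≤ n) (hk : k ≤ m) :
    0 ≤ weight n m k := le_trans (by positivity) (weight_ge hm h hk)

lemma sum_sq_sub_sq (m : ℕ) (c : ℝ) :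
    ∑ k ∈ Finset.Icc 1 m, ((k : ℝ) ^ 2 - c) ^ 2 =
      m * (m + 1) * (2 * m + 1) * (3 * m ^ 2 + 3 * m - 1) / 30
        - 2 * c * (m * (m + 1) * (2 * m + 1) / 6) + m * c ^ 2 := by
  induction m with
  | zero => simp
  | succ m ih =>
    rw [Finset.sum_Icc_succ_top (by omega), ih]
    push_cast
    ring

/-- The squares `1², …, m²` have spread of the full order `m⁵` about any point: the minimum over
`c` is `m (m + 1) (2 m + 1) (m - 1) (8 m + 11) / 180`, attained at their mean. -/
lemma sum_sq_sub_sq_ge {m : ℕ} (hm : 2 ≤ m) (c : ℝ) :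
    2 * (m : ℝ) ^ 5 / 45 ≤ ∑ k ∈ Finset.Icc 1 m, ((k : ℝ) ^ 2 - c) ^ 2 := by
  rw [sum_sq_sub_sq]
  obtain ⟨t, rfl⟩ := Nat.exists_eq_add_of_le hm
  push_cast
  have ht : (0 : ℝ) ≤ t := t.cast_nonneg
  rw [← sub_nonneg]
  have key : ∀ x : ℝ, x * (x + 1) * (2 * x + 1) * (3 * x ^ 2 + 3 * x - 1) / 30
      - 2 * c * (x * (x + 1) * (2 * x + 1) / 6) + x * c ^ 2 - 2 * x ^ 5 / 45
      = x * (c - (x + 1) * (2 * x + 1) / 6) ^ 2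
        + x * ((x + 1) * (2 * x + 1) * (x - 1) * (8 * x + 11) - 8 * x ^ 4) / 180 := by
    intro x; ring
  rw [key]
  have h2 : 0 ≤ ((2 + t : ℝ) + 1) * (2 * (2 + t) + 1) * ((2 + t) - 1) * (8 * (2 + t) + 11)
      - 8 * (2 + t) ^ 4 := by
    ring_nf
    positivity
  positivity

lemma sum_weight_mul_sq_ge {n m : ℕ} (hm : 2 ≤ m) (h : 2 * m ≤ n) :
    (m : ℝ) ^ 4 / (45 * (n : ℝ) ^ 4) ≤
      ∑ k ∈ Finset.Icc 1 m, weight n m k * (regressor n k - regressorMean n m) ^ 2 := by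
  have hm0 : (0 : ℝ) < m := by exact_mod_cast (by omega : 0 < m)
  have hn0 : (0 : ℝ) < n := by exact_mod_cast (by omega : 0 < n)
  calc (m : ℝ) ^ 4 / (45 * (n : ℝ) ^ 4)
      = 1 / (2 * (m : ℝ) * (n : ℝ) ^ 4) * (2 * (m : ℝ) ^ 5 / 45) := by field_simp
    _ ≤ 1 / (2 * (m : ℝ) * (n : ℝ) ^ 4) * ∑ k ∈ Finset.Icc 1 m,
          ((k : ℝ) ^ 2 - regressorMean n m * n ^ 2) ^ 2 := by
        gcongr; exact sum_sq_sub_sq_ge hm _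
    _ = ∑ k ∈ Finset.Icc 1 m,
          1 / (2 * (m : ℝ)) * (regressor n k - regressorMean n m) ^ 2 := by
        rw [Finset.mul_sum]
        refine Finset.sum_congr rfl fun k _ => ?_
        unfold regressor
        field_simp
    _ ≤ _ := by
        refine Finset.sum_le_sum fun k hk => ?_
        gcongr
        exact weight_ge (by omega) h (Finset.mem_Icc.1 hk).2

lemma regressor_nonneg (n k : ℕ) : 0 ≤ regressor n k := by unfold regressor; positivity

lemma regressor_le {n m k : ℕ} (hk : k ≤ m) : regressor n k ≤ (m : ℝ) ^ 2 / (n : ℝ) ^ 2 := by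
  unfold regressor; gcongr

lemma regressorMean_nonneg {n m : ℕ} (hm : 0 < m) (h : 2 * m ≤ n) : 0 ≤ regressorMean n m :=
  Finset.sum_nonneg fun k hk =>
    mul_nonneg (weight_nonneg hm h (Finset.mem_Icc.1 hk).2) (regressor_nonneg n k)

lemma regressorMean_le {n m : ℕ} (hm : 0 < m) (h : 2 * m ≤ n) :
    regressorMean n m ≤ (m : ℝ) ^ 2 / (n : ℝ) ^ 2 := by
  calc regressorMean n m
      ≤ ∑ k ∈ Finset.Icc 1 m, weight n m k * ((m : ℝ) ^ 2 / (n : ℝ) ^ 2) := by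
        refine Finset.sum_le_sum fun k hk => ?_
        have hk' := (Finset.mem_Icc.1 hk).2
        exact mul_le_mul_of_nonneg_left (regressor_le hk') (weight_nonneg hm h hk')
    _ = _ := by rw [← Finset.sum_mul, sum_weight hm h, one_mul]

/-- The multipliers stay bounded, since `d̄_w |d_k - d̄_w|` is at most `(m / n)⁴`, which is the order
of the weighted spread of the regressors. -/
lemma abs_interceptCoef_le {n m k : ℕ} (hm : 2 ≤ m) (h : 2 * m ≤ n) (hk : k ≤ m) :
    |interceptCoef n m k| ≤ 46 := by
  have hm0 : (0 : ℝ) < m := by exact_mod_cast (by omega : 0 < m)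
  have hn0 : (0 : ℝ) < n := by exact_mod_cast (by omega : 0 < n)
  have hV := sum_weight_mul_sq_ge hm h
  unfold interceptCoef
  set V := ∑ j ∈ Finset.Icc 1 m, weight n m j * (regressor n j - regressorMean n m) ^ 2
  have hV0 : 0 < V := lt_of_lt_of_le (by positivity) hV
  have hd1 := regressorMean_nonneg (by omega : 0 < m) h
  have hd2 := regressorMean_le (by omega : 0 < m) h
  have h1 := regressor_nonneg n k
  have h2 := regressor_le (n := n) hk
  set D := regressorMean n m
  set q := (m : ℝ) ^ 2 / (n : ℝ) ^ 2
  have hq : q ^ 2 ≤ 45 * V := by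
    have : q ^ 2 = 45 * ((m : ℝ) ^ 4 / (45 * (n : ℝ) ^ 4)) := by simp only [q]; field_simp
    linarith
  have h3 : |regressor n k - D| ≤ q := abs_le.2 ⟨by linarith, by linarith⟩
  have h4 : |D * (regressor n k - D) / V| ≤ 45 := by
    rw [abs_div, abs_mul, abs_of_pos hV0, abs_of_nonneg hd1, div_le_iff₀ hV0]
    nlinarith [abs_nonneg (regressor n k - D)]
  have := abs_sub 1 (D * (regressor n k - D) / V)
  rw [abs_one] at this
  linarith

lemma sum_interceptCoef_mul {n m : ℕ} (hm : 0 < m) (h : 2 * m ≤ n) :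
    ∑ k ∈ Finset.Icc 1 m, interceptCoef n m k * ((n : ℝ) - k) = numPairs n m := by
  have hN := numPairs_pos hm h
  have h0 : ∑ k ∈ Finset.Icc 1 m, weight n m k * (regressor n k - regressorMean n m) = 0 := by
    simp only [mul_sub, Finset.sum_sub_distrib, ← Finset.sum_mul, sum_weight hm h, one_mul]
    exact sub_self _
  have h1 : ∑ k ∈ Finset.Icc 1 m, interceptCoef n m k * weight n m k = 1 := by
    have : ∀ k, interceptCoef n m k * weight n m k = weight n m k - regressorMean n m /
        (∑ j ∈ Finset.Icc 1 m, weight n m j * (regressor n j - regressorMean n m) ^ 2) *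
        (weight n m k * (regressor n k - regressorMean n m)) := fun k => by
      unfold interceptCoef; ring
    simp only [this, Finset.sum_sub_distrib, ← Finset.mul_sum, h0, sum_weight hm h]
    simp
  have h2 : ∀ k, interceptCoef n m k * ((n : ℝ) - k)
      = numPairs n m * (interceptCoef n m k * weight n m k) := fun k => by
    unfold weight; field_simp
  simp only [h2, ← Finset.mul_sum, h1, mul_one]

lemma lsEstimator_eq {n m : ℕ} (y : ℕ → ℝ) (hmn : m < n) :
    lsEstimator y n m = (2 * numPairs n m)⁻¹ * ∑ k ∈ Finset.Icc 1 m,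
      interceptCoef n m k * ∑ i ∈ Finset.range (n - k), (y (i + k) - y i) ^ 2 := by
  rw [lsEstimator_eq_sum_interceptCoef, Finset.mul_sum]
  refine Finset.sum_congr rfl fun k hk => ?_
  rw [weight_mul_lagRice y (lt_of_le_of_lt (Finset.mem_Icc.1 hk).2 hmn)]
  ring

/-! ### The regression function -/

lemma HasBoundedSecondDeriv.exists_lipschitz {g : ℝ → ℝ} (hg : HasBoundedSecondDeriv g) :
    ∃ L : ℝ, 0 ≤ L ∧ ∀ x ∈ Icc (0 : ℝ) 1, ∀ y ∈ Icc (0 : ℝ) 1, |g y - g x| ≤ L * |y - x| := by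
  obtain ⟨h1, h2, -⟩ := hg
  obtain ⟨L, hL⟩ := isCompact_Icc.exists_bound_of_continuousOn h2.continuousOn
  refine ⟨L, (norm_nonneg _).trans (hL 0 (by simp)), fun x hx y hy => ?_⟩
  exact (convex_Icc 0 1).norm_image_sub_le_of_norm_derivWithin_le h1 hL hx hy

/-! ### Bounds in mean -/

variable {Ω : Type*} [MeasurableSpace Ω] {P : Measure Ω}

/-- `X` is integrable with `E|X| ≤ c`. -/
def MeanAbsLe (P : Measure Ω) (X : Ω → ℝ) (c : ℝ) : Prop :=
  Integrable X P ∧ ∫ ω, |X ω| ∂P ≤ c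

lemma MeanAbsLe.mono {X : Ω → ℝ} {c d : ℝ} (h : MeanAbsLe P X c) (hcd : c ≤ d) :
    MeanAbsLe P X d := ⟨h.1, h.2.trans hcd⟩

lemma MeanAbsLe.add {X Y : Ω → ℝ} {c d : ℝ} (hX : MeanAbsLe P X c) (hY : MeanAbsLe P Y d) :
    MeanAbsLe P (fun ω => X ω + Y ω) (c + d) := by
  refine ⟨hX.1.add hY.1, ?_⟩
  calc ∫ ω, |X ω + Y ω| ∂P ≤ ∫ ω, (|X ω| + |Y ω|) ∂P :=
        integral_mono (hX.1.add hY.1).abs (hX.1.abs.add hY.1.abs) fun ω => abs_add_le _ _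
    _ = ∫ ω, |X ω| ∂P + ∫ ω, |Y ω| ∂P := integral_add hX.1.abs hY.1.abs
    _ ≤ c + d := add_le_add hX.2 hY.2

lemma MeanAbsLe.const_mul {X : Ω → ℝ} {c : ℝ} (a : ℝ) (hX : MeanAbsLe P X c) :
    MeanAbsLe P (fun ω => a * X ω) (|a| * c) := by
  refine ⟨hX.1.const_mul a, ?_⟩
  simp only [abs_mul, integral_const_mul]
  exact mul_le_mul_of_nonneg_left hX.2 (abs_nonneg a)

lemma MeanAbsLe.sub {X Y : Ω → ℝ} {c d : ℝ} (hX : MeanAbsLe P X c) (hY : MeanAbsLe P Y d) :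
    MeanAbsLe P (fun ω => X ω - Y ω) (c + d) := by
  simpa [sub_eq_add_neg] using hX.add (hY.const_mul (-1))

lemma MeanAbsLe.sum {ι : Type*} {X : ι → Ω → ℝ} {c : ι → ℝ} (s : Finset ι)
    (h : ∀ i ∈ s, MeanAbsLe P (X i) (c i)) :
    MeanAbsLe P (fun ω => ∑ i ∈ s, X i ω) (∑ i ∈ s, c i) := by
  classical
  induction s using Finset.induction_on with
  | empty => simp [MeanAbsLe]
  | insert a s ha ih =>
    simp only [Finset.sum_insert ha]
    exact (h a (Finset.mem_insert_self a s)).add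
      (ih fun i hi => h i (Finset.mem_insert_of_mem hi))

lemma MeanAbsLe.const [IsProbabilityMeasure P] {a c : ℝ} (h : |a| ≤ c) :
    MeanAbsLe P (fun _ => a) c :=
  ⟨integrable_const a, by simpa using h⟩

lemma MeanAbsLe.of_memLp_two [IsProbabilityMeasure P] {X : Ω → ℝ} (hX : MemLp X 2 P) {v : ℝ}
    (hv : ∫ ω, X ω ^ 2 ∂P ≤ v) : MeanAbsLe P X √v := by
  refine ⟨hX.integrable (by norm_num), Real.le_sqrt_of_sq_le ?_⟩
  have h1 := variance_eq_sub hX.abs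
  have h2 := variance_nonneg |X| P
  simp only [Pi.pow_apply, Pi.abs_apply, sq_abs] at h1
  linarith

/-- The average of `b_k F_{k, i}` over the `N` pairs of a lag `k` and a position `i < n - k`. -/
lemma MeanAbsLe.average {n m : ℕ} (hmn : m < n) (hN : 0 < numPairs n m) {b : ℕ → ℝ} {B : ℝ}
    (hb : ∀ k ∈ Finset.Icc 1 m, |b k| ≤ B) {F : ℕ → ℕ → Ω → ℝ} {c : ℝ}
    (hc : 0 ≤ c) (hF : ∀ k ∈ Finset.Icc 1 m, ∀ i < n - k, MeanAbsLe P (F k i) c) :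
    MeanAbsLe P (fun ω => (numPairs n m)⁻¹ *
      ∑ k ∈ Finset.Icc 1 m, b k * ∑ i ∈ Finset.range (n - k), F k i ω) (B * c) := by
  refine ((MeanAbsLe.sum (Finset.Icc 1 m) fun k hk => (MeanAbsLe.sum (Finset.range (n - k))
    fun i hi => hF k hk i (Finset.mem_range.1 hi)).const_mul (b k)).const_mul
      (numPairs n m)⁻¹).mono ?_
  rw [abs_of_pos (inv_pos.2 hN), inv_mul_le_iff₀ hN, numPairs, Finset.sum_mul]
  refine Finset.sum_le_sum fun k hk => ?_
  have hk' : k ≤ n := ((Finset.mem_Icc.1 hk).2.trans hmn.le)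
  simp only [Finset.sum_const, Finset.card_range, nsmul_eq_mul]
  rw [Nat.cast_sub hk']
  have h0 : (0 : ℝ) ≤ (n : ℝ) - k := by
    have : (k : ℝ) ≤ n := by exact_mod_cast hk'
    linarith
  calc |b k| * (((n : ℝ) - k) * c) ≤ B * (((n : ℝ) - k) * c) :=
        mul_le_mul_of_nonneg_right (hb k hk) (by positivity)
    _ = _ := by ring

/-- Slutsky's theorem for a difference that is negligible in mean. -/
lemma tendstoInDistribution_of_meanAbsLe_sub [IsProbabilityMeasure P]
    {Ω' : Type*} [MeasurableSpace Ω'] {P' : Measure Ω'} [IsProbabilityMeasure P']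
    {X Y : ℕ → Ω → ℝ} {Z : Ω' → ℝ} (hX : TendstoInDistribution X atTop Z (fun _ => P) P')
    (hY : ∀ n, AEMeasurable (Y n) P) {c : ℕ → ℝ} (hc : Tendsto c atTop (𝓝 0))
    (h : ∀ᶠ n in atTop, MeanAbsLe P (fun ω => Y n ω - X n ω) (c n)) :
    TendstoInDistribution Y atTop Z (fun _ => P) P' := by
  refine tendstoInDistribution_of_tendstoInMeasure_sub Y Z hX ?_ hY
  refine tendstoInMeasure_of_tendsto_eLpNorm (p := 1) one_ne_zero
    (fun n => ((hY n).sub (hX.forall_aemeasurable n)).aestronglyMeasurable)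
    aestronglyMeasurable_zero ?_
  have hc' : Tendsto (fun n => ENNReal.ofReal (c n)) atTop (𝓝 0) := by
    simpa using ENNReal.tendsto_ofReal hc
  refine tendsto_of_tendsto_of_tendsto_of_le_of_le' tendsto_const_nhds hc'
    (Eventually.of_forall fun n => zero_le) ?_
  filter_upwards [h] with n hn
  rw [sub_zero, eLpNorm_one_eq_lintegral_enorm]
  change ∫⁻ ω, ‖Y n ω - X n ω‖ₑ ∂P ≤ _
  rw [← ofReal_integral_norm_eq_lintegral_enorm hn.1]
  exact ENNReal.ofReal_le_ofReal hn.2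

/-! ### Products of independent errors -/

lemma integral_sq_sum_of_orthogonal {ι : Type*} (s : Finset ι) (F : ι → Ω → ℝ) (a : ι → ℝ)
    (hF : ∀ p ∈ s, MemLp (F p) 2 P)
    (horth : ∀ p ∈ s, ∀ q ∈ s, p ≠ q → ∫ ω, F p ω * F q ω ∂P = 0) :
    ∫ ω, (∑ p ∈ s, a p * F p ω) ^ 2 ∂P = ∑ p ∈ s, a p ^ 2 * ∫ ω, F p ω ^ 2 ∂P := by
  have hint : ∀ p ∈ s, ∀ q ∈ s, Integrable (fun ω => a p * a q * (F p ω * F q ω)) P :=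
    fun p hp q hq => ((hF p hp).integrable_mul (hF q hq)).const_mul _
  have h1 : ∀ ω, (∑ p ∈ s, a p * F p ω) ^ 2
      = ∑ p ∈ s, ∑ q ∈ s, a p * a q * (F p ω * F q ω) := fun ω => by
    rw [sq, Finset.sum_mul_sum]
    exact Finset.sum_congr rfl fun p _ => Finset.sum_congr rfl fun q _ => by ring
  simp only [h1]
  rw [integral_finsetSum s fun p hp => integrable_finsetSum s fun q hq => hint p hp q hq]
  refine Finset.sum_congr rfl fun p hp => ?_
  rw [integral_finsetSum s fun q hq => hint p hp q hq, Finset.sum_eq_single_of_mem p hp]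
  · rw [integral_const_mul]
    simp only [sq]
  · intro q hq hqp
    rw [integral_const_mul, horth p hp q hq hqp.symm, mul_zero]

lemma integral_mul_mul_mul_eq_zero {ε : ℕ → Ω → ℝ} (hindep : iIndepFun ε P)
    (hmeas : ∀ i, AEMeasurable (ε i) P) {a b c d : ℕ} (hmean : ∫ ω, ε a ω ∂P = 0)
    (hab : a ≠ b) (hac : a ≠ c) (had : a ≠ d) :
    ∫ ω, ε a ω * (ε b ω * ε c ω * ε d ω) ∂P = 0 := by
  have h1 := hindep.indepFun_finset₀ {a} {b, c, d} (by simp [hab, hac, had]) hmeas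
  have hφ : Measurable fun x : ({a} : Finset ℕ) → ℝ => x ⟨a, by simp⟩ := by fun_prop
  have hψ : Measurable fun x : ({b, c, d} : Finset ℕ) → ℝ =>
      x ⟨b, by simp⟩ * x ⟨c, by simp⟩ * x ⟨d, by simp⟩ := by fun_prop
  have h2 := h1.comp hφ hψ
  have h3 := h2.integral_fun_mul_eq_mul_integral
    (hmeas a).aestronglyMeasurable
    (((hmeas b).mul (hmeas c)).mul (hmeas d)).aestronglyMeasurable
  simp only [Function.comp_def, hmean, zero_mul] at h3
  exact h3

/-- Products over two distinct pairs of indices are uncorrelated: one of the four indices occurs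
exactly once. -/
lemma integral_pair_mul_pair_eq_zero {ε : ℕ → Ω → ℝ} (hindep : iIndepFun ε P)
    (hmeas : ∀ i, AEMeasurable (ε i) P) (hmean : ∀ i, ∫ ω, ε i ω ∂P = 0)
    {i i' j j' : ℕ} (hi : i < i') (hj : j < j') (hne : ¬(i = j ∧ i' = j')) :
    ∫ ω, (ε i ω * ε i' ω) * (ε j ω * ε j' ω) ∂P = 0 := by
  rcases lt_trichotomy i' j' with h | h | h
  · rw [← integral_mul_mul_mul_eq_zero hindep hmeas (hmean j') (b := i) (c := i') (d := j)
      (by omega) (by omega) (by omega)]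
    exact integral_congr_ae (ae_of_all _ fun ω => by ring)
  · rw [← integral_mul_mul_mul_eq_zero hindep hmeas (hmean i) (b := i') (c := j) (d := j')
      (by omega) (by omega) (by omega)]
    exact integral_congr_ae (ae_of_all _ fun ω => by ring)
  · rw [← integral_mul_mul_mul_eq_zero hindep hmeas (hmean i') (b := i) (c := j) (d := j')
      (by omega) (by omega) (by omega)]
    exact integral_congr_ae (ae_of_all _ fun ω => by ring)

lemma integral_sq_mul_sq {ε : ℕ → Ω → ℝ} (hindep : iIndepFun ε P)
    (hmeas : ∀ i, AEMeasurable (ε i) P) {σ : ℝ} (hvar : ∀ i, ∫ ω, ε i ω ^ 2 ∂P = σ ^ 2)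
    {i j : ℕ} (hij : i ≠ j) : ∫ ω, (ε i ω * ε j ω) ^ 2 ∂P = σ ^ 4 := by
  have h := ((hindep.indepFun hij).comp (φ := fun x : ℝ => x ^ 2) (ψ := fun x : ℝ => x ^ 2)
    (by fun_prop) (by fun_prop)).integral_fun_mul_eq_mul_integral
    ((hmeas i).pow_const 2).aestronglyMeasurable ((hmeas j).pow_const 2).aestronglyMeasurable
  simp only [Function.comp_def, hvar] at h
  simp only [mul_pow]
  rw [h]
  ring

lemma memLp_two_mul {X Y : Ω → ℝ} (hX : MemLp X 4 P) (hY : MemLp Y 4 P) :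
    MemLp (fun ω => X ω * Y ω) 2 P := by
  have : ENNReal.HolderTriple 4 4 2 := ⟨by
    rw [← two_mul, show (4 : ENNReal) = 2 * 2 by norm_num,
      ENNReal.mul_inv (by simp) (by simp), ← mul_assoc,
      ENNReal.mul_inv_cancel (by simp) (by simp), one_mul]⟩
  exact hY.mul hX

/-- Since the products `ε_i ε_{i+k}` are uncorrelated, averaging over the `N` pairs gains the full
factor `N⁻¹ᐟ²`. -/
lemma meanAbsLe_crossTerm [IsProbabilityMeasure P] {ε : ℕ → Ω → ℝ} (hindep : iIndepFun ε P)
    (hmem : ∀ i, MemLp (ε i) 4 P) (hmean : ∀ i, ∫ ω, ε i ω ∂P = 0) {σ : ℝ}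
    (hvar : ∀ i, ∫ ω, ε i ω ^ 2 ∂P = σ ^ 2) {n m : ℕ} (hm : 0 < m) (hmn : 2 * m ≤ n)
    {b : ℕ → ℝ} {B : ℝ} (hb : ∀ k ∈ Finset.Icc 1 m, |b k| ≤ B) :
    MeanAbsLe P (fun ω => (numPairs n m)⁻¹ * ∑ k ∈ Finset.Icc 1 m,
      b k * ∑ i ∈ Finset.range (n - k), ε i ω * ε (i + k) ω)
      √(2 * B ^ 2 * σ ^ 4 / (n * m)) := by
  have hmeas : ∀ i, AEMeasurable (ε i) P := fun i => (hmem i).aestronglyMeasurable.aemeasurable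
  have hN := numPairs_pos hm hmn
  have hm' : (0 : ℝ) < m := by exact_mod_cast hm
  have hn' : (0 : ℝ) < n := by exact_mod_cast (by omega : 0 < n)
  set s : Finset (Σ _ : ℕ, ℕ) := (Finset.Icc 1 m).sigma fun k => Finset.range (n - k)
  have hs : ∀ p ∈ s, 1 ≤ p.1 ∧ p.1 ≤ m ∧ p.2 < n - p.1 := by
    intro p hp
    simpa [s, and_assoc] using hp
  have heq : ∀ ω, (numPairs n m)⁻¹ * ∑ k ∈ Finset.Icc 1 m,
      b k * ∑ i ∈ Finset.range (n - k), ε i ω * ε (i + k) ω =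
      ∑ p ∈ s, ((numPairs n m)⁻¹ * b p.1) * (ε p.2 ω * ε (p.2 + p.1) ω) := fun ω => by
    rw [Finset.sum_sigma]
    simp only [Finset.mul_sum]
    exact Finset.sum_congr rfl fun p _ => Finset.sum_congr rfl fun q _ => by ring
  have hF : ∀ p ∈ s, MemLp (fun ω => ε p.2 ω * ε (p.2 + p.1) ω) 2 P :=
    fun p _ => memLp_two_mul (hmem _) (hmem _)
  simp only [heq]
  refine MeanAbsLe.of_memLp_two (memLp_finsetSum s fun p hp => (hF p hp).const_mul _) ?_
  rw [integral_sq_sum_of_orthogonal s (fun p ω => ε p.2 ω * ε (p.2 + p.1) ω)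
    (fun p => (numPairs n m)⁻¹ * b p.1) hF ?_]
  · calc ∑ p ∈ s, ((numPairs n m)⁻¹ * b p.1) ^ 2 * ∫ ω, (ε p.2 ω * ε (p.2 + p.1) ω) ^ 2 ∂P
        ≤ ∑ p ∈ s, ((numPairs n m)⁻¹ * B) ^ 2 * σ ^ 4 := by
          refine Finset.sum_le_sum fun p hp => ?_
          obtain ⟨h1, h2, h3⟩ := hs p hp
          rw [integral_sq_mul_sq hindep hmeas hvar (by omega), mul_pow, mul_pow,
            ← sq_abs (b p.1)]
          have := hb p.1 (Finset.mem_Icc.2 ⟨h1, h2⟩)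
          gcongr
      _ = B ^ 2 * σ ^ 4 / numPairs n m := by
          have hcard : (s.card : ℝ) = numPairs n m := by
            rw [Finset.card_sigma, Nat.cast_sum, numPairs]
            refine Finset.sum_congr rfl fun k hk => ?_
            have := (Finset.mem_Icc.1 hk).2
            rw [Finset.card_range, Nat.cast_sub (by omega)]
          rw [Finset.sum_const, nsmul_eq_mul, hcard]
          field_simp
      _ ≤ B ^ 2 * σ ^ 4 / (n * m / 2) := by
          gcongr
          exact numPairs_ge hmn
      _ = _ := by field_simp
  · intro p hp q hq hpq
    obtain ⟨h1, h2, h3⟩ := hs p hp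
    obtain ⟨h4, h5, h6⟩ := hs q hq
    refine integral_pair_mul_pair_eq_zero hindep hmeas hmean (by omega) (by omega) ?_
    rintro ⟨h7, h8⟩
    exact hpq (Sigma.ext (by omega) (heq_of_eq h7))

/-! ### Comparison of the estimator with the mean of the squared errors -/

lemma sum_add_shift (η : ℕ → ℝ) {n k : ℕ} (hk : k ≤ n) :
    ∑ i ∈ Finset.range (n - k), (η (i + k) + η i) = 2 * ∑ i ∈ Finset.range n, η i
      - (∑ i ∈ Finset.range k, η i + ∑ i ∈ Finset.range k, η (n - k + i)) := by
  have h1 := Finset.sum_range_add η k (n - k)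
  have h2 := Finset.sum_range_add η (n - k) k
  rw [Nat.add_sub_cancel' hk] at h1
  rw [Nat.sub_add_cancel hk] at h2
  have h3 : ∑ i ∈ Finset.range (n - k), η (i + k) = ∑ i ∈ Finset.range (n - k), η (k + i) :=
    Finset.sum_congr rfl fun i _ => by rw [add_comm]
  rw [Finset.sum_add_distrib, h3]
  linarith

/-- The error of the estimator, minus the mean of the `ε_i² - v`, is the sum of a bias term, a term
linear in the errors, a bilinear one, and the terms that stem from the first and the last `k`
errors occurring in one pair of lag `k` instead of two. -/
lemma lsEstimator_sub_mean_sq (g : ℝ → ℝ) (e : ℕ → ℝ) (v : ℝ) {n m : ℕ} (hm : 0 < m)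
    (hmn : 2 * m ≤ n) :
    lsEstimator (obs g e n) n m - v - (n : ℝ)⁻¹ * ∑ i ∈ Finset.range n, (e i ^ 2 - v) =
      2⁻¹ * ((numPairs n m)⁻¹ * ∑ k ∈ Finset.Icc 1 m, interceptCoef n m k *
        ∑ i ∈ Finset.range (n - k), (obs g 0 n (i + k) - obs g 0 n i) ^ 2) +
      (numPairs n m)⁻¹ * ∑ k ∈ Finset.Icc 1 m, interceptCoef n m k *
        ∑ i ∈ Finset.range (n - k),
          (obs g 0 n (i + k) - obs g 0 n i) * (e (i + k) - e i) -
      (numPairs n m)⁻¹ * ∑ k ∈ Finset.Icc 1 m, interceptCoef n m k *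
        ∑ i ∈ Finset.range (n - k), e i * e (i + k) +
      (((n : ℝ) * numPairs n m)⁻¹ * ∑ k ∈ Finset.Icc 1 m, interceptCoef n m k * k) *
        ∑ i ∈ Finset.range n, (e i ^ 2 - v) -
      (2 * numPairs n m)⁻¹ * ∑ k ∈ Finset.Icc 1 m, interceptCoef n m k *
        (∑ i ∈ Finset.range k, (e i ^ 2 - v) +
          ∑ i ∈ Finset.range k, (e (n - k + i) ^ 2 - v)) := by
  have hN := numPairs_pos hm hmn
  have hn' : (0 : ℝ) < n := by exact_mod_cast (by omega : 0 < n)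
  have hsum := sum_interceptCoef_mul hm hmn
  rw [lsEstimator_eq _ (by omega)]
  set N := numPairs n m
  set T := ∑ i ∈ Finset.range n, (e i ^ 2 - v) with hT
  set b := interceptCoef n m
  have hk : ∀ k ∈ Finset.Icc 1 m,
      b k * ∑ i ∈ Finset.range (n - k), (obs g e n (i + k) - obs g e n i) ^ 2 =
      b k * ∑ i ∈ Finset.range (n - k), (obs g 0 n (i + k) - obs g 0 n i) ^ 2 +
      2 * (b k * ∑ i ∈ Finset.range (n - k),
          (obs g 0 n (i + k) - obs g 0 n i) * (e (i + k) - e i)) -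
      2 * (b k * ∑ i ∈ Finset.range (n - k), e i * e (i + k)) +
      (2 * T * b k - b k * (∑ i ∈ Finset.range k, (e i ^ 2 - v) +
          ∑ i ∈ Finset.range k, (e (n - k + i) ^ 2 - v)) + 2 * v * (b k * ((n : ℝ) - k))) := by
    intro k hk
    have hkm := (Finset.mem_Icc.1 hk).2
    have h1 := sum_add_shift (fun i => e i ^ 2 - v) (n := n) (k := k) (by omega)
    rw [← hT] at h1
    have h2 : ∑ i ∈ Finset.range (n - k), (obs g e n (i + k) - obs g e n i) ^ 2 =
        ∑ i ∈ Finset.range (n - k), (obs g 0 n (i + k) - obs g 0 n i) ^ 2 +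
        2 * ∑ i ∈ Finset.range (n - k),
          (obs g 0 n (i + k) - obs g 0 n i) * (e (i + k) - e i) -
        2 * ∑ i ∈ Finset.range (n - k), e i * e (i + k) +
        (∑ i ∈ Finset.range (n - k), ((e (i + k) ^ 2 - v) + (e i ^ 2 - v)) +
          2 * v * ((n : ℝ) - k)) := by
      have h3 : 2 * v * ((n : ℝ) - k) = ∑ i ∈ Finset.range (n - k), 2 * v := by
        rw [Finset.sum_const, Finset.card_range, nsmul_eq_mul, Nat.cast_sub (by omega)]
        ring
      rw [h3, Finset.mul_sum, Finset.mul_sum, ← Finset.sum_add_distrib, ← Finset.sum_add_distrib,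
        ← Finset.sum_sub_distrib, ← Finset.sum_add_distrib]
      refine Finset.sum_congr rfl fun i _ => ?_
      simp only [obs, Pi.zero_apply]
      ring
    rw [h2, h1]
    ring
  have hb : N = n * ∑ k ∈ Finset.Icc 1 m, b k - ∑ k ∈ Finset.Icc 1 m, b k * k := by
    rw [← hsum, Finset.mul_sum, ← Finset.sum_sub_distrib]
    exact Finset.sum_congr rfl fun k _ => by ring
  rw [Finset.sum_congr rfl hk]
  simp only [Finset.sum_add_distrib, Finset.sum_sub_distrib, ← Finset.mul_sum, hsum]
  generalize ∑ k ∈ Finset.Icc 1 m, b k * k = S₁ at *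
  obtain ⟨S₀, hS₀⟩ : ∃ S₀, S₀ = ∑ k ∈ Finset.Icc 1 m, b k := ⟨_, rfl⟩
  rw [← hS₀] at hb ⊢
  have hS : S₁ = n * S₀ - N := by linarith
  rw [hS]
  field_simp
  ring

lemma meanAbsLe_boundary {η : ℕ → Ω → ℝ} {K : ℝ} (hη : ∀ i, MeanAbsLe P (η i) K) (n k : ℕ) :
    MeanAbsLe P (fun ω => ∑ i ∈ Finset.range k, η i ω + ∑ i ∈ Finset.range k, η (n - k + i) ω)
      (2 * k * K) := by
  refine ((MeanAbsLe.sum (Finset.range k) fun i _ => hη i).add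
    (MeanAbsLe.sum (Finset.range k) fun i _ => hη (n - k + i))).mono (le_of_eq ?_)
  simp only [Finset.sum_const, Finset.card_range, nsmul_eq_mul]
  ring

lemma abs_obs_zero_sub_le {g : ℝ → ℝ} {L : ℝ} (hL : 0 ≤ L)
    (hg : ∀ x ∈ Icc (0 : ℝ) 1, ∀ y ∈ Icc (0 : ℝ) 1, |g y - g x| ≤ L * |y - x|)
    {n m k i : ℕ} (hkm : k ≤ m) (hi : i + k < n) :
    |obs g 0 n (i + k) - obs g 0 n i| ≤ L * (m / n) := by
  have hn : (0 : ℝ) < n := by exact_mod_cast (by omega : 0 < n)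
  have h1 : ∀ j : ℕ, j < n → ((j : ℝ) + 1) / n ∈ Icc (0 : ℝ) 1 := fun j hj =>
    ⟨by positivity, by rw [div_le_one hn]; exact_mod_cast hj⟩
  have h2 := hg _ (h1 i (by omega)) _ (h1 (i + k) hi)
  have h3 : (((i + k : ℕ) : ℝ) + 1) / n - ((i : ℝ) + 1) / n = k / n := by
    push_cast; ring
  rw [h3, abs_of_nonneg (by positivity : (0 : ℝ) ≤ k / n)] at h2
  simp only [obs, Pi.zero_apply, add_zero]
  refine h2.trans ?_
  gcongr

/-- Up to a term of order `m / n + 1 / √(n m)` in mean, the error of the estimator is the mean of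
the centred squared errors. -/
lemma meanAbsLe_lsEstimator_sub [IsProbabilityMeasure P] {g : ℝ → ℝ} {L : ℝ} (hL : 0 ≤ L)
    (hg : ∀ x ∈ Icc (0 : ℝ) 1, ∀ y ∈ Icc (0 : ℝ) 1, |g y - g x| ≤ L * |y - x|)
    {ε : ℕ → Ω → ℝ} (hindep : iIndepFun ε P) (hmem : ∀ i, MemLp (ε i) 4 P)
    (hmean : ∀ i, ∫ ω, ε i ω ∂P = 0) {σ : ℝ} (hσ : 0 < σ)
    (hvar : ∀ i, ∫ ω, ε i ω ^ 2 ∂P = σ ^ 2) {K : ℝ} (hK : 0 ≤ K)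
    (hη : ∀ i, MeanAbsLe P (fun ω => ε i ω ^ 2 - σ ^ 2) K) {n m : ℕ} (hm : 2 ≤ m)
    (hmn : 2 * m ≤ n) :
    MeanAbsLe P (fun ω => lsEstimator (obs g (fun i => ε i ω) n) n m - σ ^ 2 -
        (n : ℝ)⁻¹ * ∑ i ∈ Finset.range n, (ε i ω ^ 2 - σ ^ 2))
      ((23 * L ^ 2 + 92 * L * σ + 184 * K) * (m / n) + √(2 * 46 ^ 2 * σ ^ 4 / (n * m))) := by
  have hm0 : 0 < m := by omega
  have hN := numPairs_pos hm0 hmn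
  have hN2 := numPairs_ge hmn
  have hm' : (0 : ℝ) < m := by exact_mod_cast hm0
  have hn' : (0 : ℝ) < n := by exact_mod_cast (by omega : 0 < n)
  have hq : (m : ℝ) / n ≤ 1 := by
    rw [div_le_one hn']; exact_mod_cast (by omega : m ≤ n)
  have hb : ∀ k ∈ Finset.Icc 1 m, |interceptCoef n m k| ≤ 46 := fun k hk =>
    abs_interceptCoef_le hm hmn (Finset.mem_Icc.1 hk).2
  have hε : ∀ i, MeanAbsLe P (ε i) σ := fun i => by
    have := MeanAbsLe.of_memLp_two ((hmem i).mono_exponent (by norm_num)) (hvar i).le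
    rwa [Real.sqrt_sq hσ.le] at this
  have hδ : ∀ k ∈ Finset.Icc 1 m, ∀ i < n - k,
      |obs g 0 n (i + k) - obs g 0 n i| ≤ L * (m / n) := fun k hk i hi =>
    abs_obs_zero_sub_le hL hg (Finset.mem_Icc.1 hk).2 (by omega)
  have hA := MeanAbsLe.average (P := P) (m := m) (n := n) (by omega) hN hb
    (F := fun k i _ => (obs g 0 n (i + k) - obs g 0 n i) ^ 2) (c := (L * (m / n)) ^ 2)
    (by positivity) (fun k hk i hi => MeanAbsLe.const (by
      rw [abs_pow]; gcongr; exact hδ k hk i hi))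
  have hB := MeanAbsLe.average (P := P) (m := m) (n := n) (by omega) hN hb
    (F := fun k i ω => (obs g 0 n (i + k) - obs g 0 n i) * (ε (i + k) ω - ε i ω))
    (c := L * (m / n) * (σ + σ)) (by positivity)
    (fun k hk i hi => (((hε (i + k)).sub (hε i)).const_mul _).mono (by
      gcongr; exact hδ k hk i hi))
  have hC := meanAbsLe_crossTerm hindep hmem hmean hvar hm0 hmn hb
  have hT : MeanAbsLe P (fun ω => ∑ i ∈ Finset.range n, (ε i ω ^ 2 - σ ^ 2)) (n * K) := by
    simpa using MeanAbsLe.sum (Finset.range n) fun i _ => hη i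
  have hD := (hT.const_mul (((n : ℝ) * numPairs n m)⁻¹ *
    ∑ k ∈ Finset.Icc 1 m, interceptCoef n m k * k))
  have hE := (MeanAbsLe.sum (Finset.Icc 1 m) fun k _ =>
    (meanAbsLe_boundary hη n k).const_mul (interceptCoef n m k)).const_mul (2 * numPairs n m)⁻¹
  have hS : ∑ k ∈ Finset.Icc 1 m, |interceptCoef n m k| * k ≤ 46 * m ^ 2 := by
    calc ∑ k ∈ Finset.Icc 1 m, |interceptCoef n m k| * k
        ≤ ∑ k ∈ Finset.Icc 1 m, (46 * m : ℝ) := by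
          refine Finset.sum_le_sum fun k hk => ?_
          have := (Finset.mem_Icc.1 hk).2
          gcongr
          exact hb k hk
      _ = _ := by
          simp only [Finset.sum_const, Nat.card_Icc, nsmul_eq_mul, Nat.add_sub_cancel]
          ring
  have hNinv : (numPairs n m)⁻¹ ≤ 2 / (n * m) := by
    rw [inv_le_comm₀ hN (by positivity), inv_div]; exact hN2
  have hD' : |((n : ℝ) * numPairs n m)⁻¹ * ∑ k ∈ Finset.Icc 1 m, interceptCoef n m k * k| *
      (n * K) ≤ 92 * K * (m / n) := by
    rw [abs_mul, abs_of_pos (by positivity), mul_inv]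
    calc (n : ℝ)⁻¹ * (numPairs n m)⁻¹ * |∑ k ∈ Finset.Icc 1 m, interceptCoef n m k * k| * (n * K)
        ≤ (n : ℝ)⁻¹ * (2 / (n * m)) * (46 * m ^ 2) * (n * K) := by
          gcongr
          refine (Finset.abs_sum_le_sum_abs _ _).trans ?_
          simpa only [abs_mul, Nat.abs_cast] using hS
      _ = _ := by field_simp; ring
  have hE' : |(2 * numPairs n m)⁻¹| * ∑ k ∈ Finset.Icc 1 m, |interceptCoef n m k| * (2 * k * K)
      ≤ 92 * K * (m / n) := by
    have h1 : ∑ k ∈ Finset.Icc 1 m, |interceptCoef n m k| * (2 * k * K)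
        = 2 * K * ∑ k ∈ Finset.Icc 1 m, |interceptCoef n m k| * k := by
      rw [Finset.mul_sum]; exact Finset.sum_congr rfl fun k _ => by ring
    rw [h1, abs_of_pos (by positivity), mul_inv]
    calc 2⁻¹ * (numPairs n m)⁻¹ *
          (2 * K * ∑ k ∈ Finset.Icc 1 m, |interceptCoef n m k| * k)
        ≤ 2⁻¹ * (2 / (n * m)) * (2 * K * (46 * m ^ 2)) := by gcongr
      _ = _ := by field_simp; ring
  have hall := ((((hA.const_mul 2⁻¹).add hB).sub hC).add (hD.mono hD')).sub (hE.mono hE')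
  simp only [lsEstimator_sub_mean_sq g _ _ hm0 hmn]
  refine hall.mono ?_
  have h2 : ((m : ℝ) / n) ^ 2 ≤ m / n := by
    rw [sq]; exact mul_le_of_le_one_left (by positivity) hq
  have h3 : L ^ 2 * ((m : ℝ) / n) ^ 2 ≤ L ^ 2 * (m / n) := by gcongr
  rw [abs_of_pos (by norm_num : (0 : ℝ) < 2⁻¹)]
  linarith [mul_pow L ((m : ℝ) / n) 2]

/-! ### Growth of the number of lags -/

lemma tendsto_lags_atTop {r : ℝ} (hr0 : 0 < r) {m : ℕ → ℕ}
    (hm : Tendsto (fun n : ℕ => (m n : ℝ) / (n : ℝ) ^ r) atTop (𝓝 1)) :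
    Tendsto (fun n => (m n : ℝ)) atTop atTop := by
  have h1 : Tendsto (fun n : ℕ => (n : ℝ) ^ r) atTop atTop :=
    (tendsto_rpow_atTop hr0).comp tendsto_natCast_atTop_atTop
  refine (h1.atTop_mul_pos one_pos hm).congr' ?_
  filter_upwards [eventually_gt_atTop 0] with n hn
  have : (0 : ℝ) < (n : ℝ) ^ r := Real.rpow_pos_of_pos (by exact_mod_cast hn) r
  field_simp

lemma tendsto_lags_div_sqrt {r : ℝ} (hr : r < 1 / 2) {m : ℕ → ℕ}
    (hm : Tendsto (fun n : ℕ => (m n : ℝ) / (n : ℝ) ^ r) atTop (𝓝 1)) :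
    Tendsto (fun n : ℕ => (m n : ℝ) / √(n : ℝ)) atTop (𝓝 0) := by
  have h1 : Tendsto (fun n : ℕ => (n : ℝ) ^ (-(1 / 2 - r))) atTop (𝓝 0) :=
    (tendsto_rpow_neg_atTop (by linarith)).comp tendsto_natCast_atTop_atTop
  have h2 := hm.mul h1
  rw [mul_zero] at h2
  refine h2.congr' ?_
  filter_upwards [eventually_gt_atTop 0] with n hn
  have hn' : (0 : ℝ) < n := by exact_mod_cast hn
  have h3 := Real.rpow_pos_of_pos hn' r
  rw [Real.sqrt_eq_rpow, show -(1 / 2 - r) = r - 1 / 2 by ring, Real.rpow_sub hn']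
  field_simp

lemma eventually_two_mul_lags_le {r : ℝ} (hr : r < 1 / 2) {m : ℕ → ℕ}
    (hm : Tendsto (fun n : ℕ => (m n : ℝ) / (n : ℝ) ^ r) atTop (𝓝 1)) :
    ∀ᶠ n : ℕ in atTop, 2 * m n ≤ n := by
  filter_upwards [(tendsto_lags_div_sqrt hr hm).eventually_le_const (by norm_num : (0 : ℝ) < 1 / 2),
    eventually_gt_atTop 0] with n h hn
  have h1 : (1 : ℝ) ≤ n := by exact_mod_cast hn
  have h2 : 0 < √(n : ℝ) := Real.sqrt_pos.2 (by linarith)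
  rw [div_le_iff₀ h2] at h
  have h3 : √(n : ℝ) ≤ n := by
    rw [Real.sqrt_le_left (by linarith)]
    nlinarith
  have h4 : (2 * m n : ℝ) ≤ n := by linarith
  exact_mod_cast h4

/-! ### Limit distributions -/

/-- If `V n - v` is the mean `n⁻¹ T n` up to `o(1 / √n)` in mean, then `√n (V n - v)` and
`T n / √n` have the same limit in distribution. -/
lemma tendstoInDistribution_sqrt_mul_sub [IsProbabilityMeasure P] {V T : ℕ → Ω → ℝ} {v : ℝ}
    {Ω' : Type*} [MeasurableSpace Ω'] {P' : Measure Ω'} [IsProbabilityMeasure P'] {Z : Ω' → ℝ}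
    (hlim : TendstoInDistribution (fun (n : ℕ) ω => (√(n : ℝ))⁻¹ * T n ω) atTop Z (fun _ => P) P')
    (hV : ∀ n, AEMeasurable (V n) P) {c : ℕ → ℝ}
    (hc : Tendsto (fun n : ℕ => √(n : ℝ) * c n) atTop (𝓝 0))
    (h : ∀ᶠ n : ℕ in atTop, MeanAbsLe P (fun ω => V n ω - v - (n : ℝ)⁻¹ * T n ω) (c n)) :
    TendstoInDistribution (fun (n : ℕ) ω => √(n : ℝ) * (V n ω - v)) atTop Z (fun _ => P) P' := by
  refine tendstoInDistribution_of_meanAbsLe_sub hlim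
    (fun n => ((hV n).sub_const _).const_mul _) hc ?_
  filter_upwards [h] with n hn
  have hninv : √(n : ℝ) * (n : ℝ)⁻¹ = (√(n : ℝ))⁻¹ := by
    rw [← div_eq_mul_inv, Real.sqrt_div_self]
  have h1 := hn.const_mul √(n : ℝ)
  rw [abs_of_nonneg (Real.sqrt_nonneg _)] at h1
  simpa only [mul_sub √(n : ℝ) (_ - _), ← mul_assoc, hninv] using h1

lemma aemeasurable_lsEstimator (g : ℝ → ℝ) {ε : ℕ → Ω → ℝ}
    (hmeas : ∀ i, AEMeasurable (ε i) P) (n m : ℕ) :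
    AEMeasurable (fun ω => lsEstimator (obs g (fun i => ε i ω) n) n m) P := by
  simp only [lsEstimator_eq_sum_interceptCoef, lagRice, obs]
  fun_prop

lemma aemeasurable_sampleVariance {ε : ℕ → Ω → ℝ} (hmeas : ∀ i, AEMeasurable (ε i) P) (n : ℕ) :
    AEMeasurable (fun ω => sampleVariance (fun i => ε i ω) n) P := by
  unfold sampleVariance
  fun_prop

lemma tendstoInDistribution_sum_sq_sub [IsProbabilityMeasure P] {ε : ℕ → Ω → ℝ}
    (hindep : iIndepFun ε P) (hident : ∀ i, IdentDistrib (ε i) (ε 0) P P)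
    (hmem : MemLp (ε 0) 4 P) {σ : ℝ} (hσ : 0 < σ) (hvar : ∫ ω, ε 0 ω ^ 2 ∂P = σ ^ 2) :
    TendstoInDistribution
      (fun (n : ℕ) ω => (√(n : ℝ))⁻¹ * ∑ i ∈ Finset.range n, (ε i ω ^ 2 - σ ^ 2))
      atTop (id : ℝ → ℝ) (fun _ => P)
      (gaussianReal 0 (Real.toNNReal ((gamma4 P (ε 0) σ - 1) * σ ^ 4))) := by
  have hsq : MemLp (fun ω => ε 0 ω ^ 2) 2 P := by
    simpa only [sq] using memLp_two_mul hmem hmem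
  have hV : Var[fun ω => ε 0 ω ^ 2; P] = (gamma4 P (ε 0) σ - 1) * σ ^ 4 := by
    rw [variance_eq_sub hsq, hvar, gamma4]
    simp only [Pi.pow_apply, ← pow_mul]
    field_simp
  have h := tendstoInDistribution_inv_sqrt_mul_sum_sub (X := fun i ω => ε i ω ^ 2) (P := P)
    (P' := gaussianReal 0 (Real.toNNReal ((gamma4 P (ε 0) σ - 1) * σ ^ 4))) (Y := id)
    (by rw [hV]; exact HasLaw.id) hsq
    (hindep.comp (fun _ x => x ^ 2) (by fun_prop))
    (fun i => (hident i).comp (u := fun x => x ^ 2) (by fun_prop))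
  simpa [hvar, Finset.sum_sub_distrib] using h

lemma tendstoInDistribution_lsEstimator [IsProbabilityMeasure P] {g : ℝ → ℝ} {L : ℝ} (hL : 0 ≤ L)
    (hg : ∀ x ∈ Icc (0 : ℝ) 1, ∀ y ∈ Icc (0 : ℝ) 1, |g y - g x| ≤ L * |y - x|)
    {ε : ℕ → Ω → ℝ} (hindep : iIndepFun ε P) (hmem : ∀ i, MemLp (ε i) 4 P)
    (hmean : ∀ i, ∫ ω, ε i ω ∂P = 0) {σ : ℝ} (hσ : 0 < σ)
    (hvar : ∀ i, ∫ ω, ε i ω ^ 2 ∂P = σ ^ 2) {K : ℝ} (hK : 0 ≤ K)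
    (hη : ∀ i, MeanAbsLe P (fun ω => ε i ω ^ 2 - σ ^ 2) K)
    {r : ℝ} (hr0 : 0 < r) (hr : r < 1 / 2) {m : ℕ → ℕ}
    (hm : Tendsto (fun n : ℕ => (m n : ℝ) / (n : ℝ) ^ r) atTop (𝓝 1))
    {μ : Measure ℝ} [IsProbabilityMeasure μ]
    (hlim : TendstoInDistribution
      (fun (n : ℕ) ω => (√(n : ℝ))⁻¹ * ∑ i ∈ Finset.range n, (ε i ω ^ 2 - σ ^ 2))
      atTop (id : ℝ → ℝ) (fun _ => P) μ) :
    TendstoInDistribution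
      (fun (n : ℕ) ω => √(n : ℝ) * (lsEstimator (obs g (fun i => ε i ω) n) n (m n) - σ ^ 2))
      atTop (id : ℝ → ℝ) (fun _ => P) μ := by
  have hmeas : ∀ i, AEMeasurable (ε i) P := fun i => (hmem i).aestronglyMeasurable.aemeasurable
  have hm1 := tendsto_lags_atTop hr0 hm
  have hm2 := tendsto_lags_div_sqrt hr hm
  refine tendstoInDistribution_sqrt_mul_sub hlim
    (fun n => aemeasurable_lsEstimator g hmeas n (m n))
    (c := fun n => (23 * L ^ 2 + 92 * L * σ + 184 * K) * (m n / n) +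
      √(2 * 46 ^ 2 * σ ^ 4 / (n * m n))) ?_ ?_
  · have h1 := (tendsto_const_nhds (x := 2 * 46 ^ 2 * σ ^ 4)).div_atTop hm1
    have h2 := (hm2.const_mul (23 * L ^ 2 + 92 * L * σ + 184 * K)).add h1.sqrt
    rw [Real.sqrt_zero, mul_zero, add_zero] at h2
    refine h2.congr' ?_
    filter_upwards [eventually_gt_atTop 0] with n hn
    have hn : (0 : ℝ) < n := by exact_mod_cast hn
    rw [mul_add, ← Real.sqrt_mul hn.le]
    congr 1
    · rw [div_eq_mul_inv, ← Real.sqrt_div_self]; ring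
    · congr 1; field_simp
  · filter_upwards [hm1.eventually_ge_atTop 2, eventually_two_mul_lags_le hr hm] with n h2 hmn
    exact meanAbsLe_lsEstimator_sub hL hg hindep hmem hmean hσ hvar hK hη
      (by exact_mod_cast h2) hmn

lemma sampleVariance_sub_eq (e : ℕ → ℝ) (v : ℝ) {n : ℕ} (hn : 2 ≤ n) :
    sampleVariance e n - v - (n : ℝ)⁻¹ * ∑ i ∈ Finset.range n, (e i ^ 2 - v) =
      ((n : ℝ) - 1)⁻¹ * ((n : ℝ)⁻¹ * ∑ i ∈ Finset.range n, (e i ^ 2 - v) +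
        (v - (n : ℝ)⁻¹ * (∑ i ∈ Finset.range n, 1 * e i) ^ 2)) := by
  have h2 : (2 : ℝ) ≤ n := by exact_mod_cast hn
  have h1 : (n : ℝ) - 1 ≠ 0 := by linarith
  have h0 : (n : ℝ) ≠ 0 := by linarith
  unfold sampleVariance
  simp only [one_mul, sub_sq, Finset.sum_add_distrib, Finset.sum_sub_distrib, ← Finset.sum_mul,
    ← Finset.mul_sum, Finset.sum_const, Finset.card_range, nsmul_eq_mul]
  generalize ∑ i ∈ Finset.range n, e i = S
  generalize ∑ i ∈ Finset.range n, e i ^ 2 = Q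
  field_simp
  ring

lemma meanAbsLe_sampleVariance_sub [IsProbabilityMeasure P]
    {ε : ℕ → Ω → ℝ} (hindep : iIndepFun ε P) (hmem : ∀ i, MemLp (ε i) 2 P)
    (hmean : ∀ i, ∫ ω, ε i ω ∂P = 0) {σ : ℝ}
    (hvar : ∀ i, ∫ ω, ε i ω ^ 2 ∂P = σ ^ 2) {K : ℝ} (hK : 0 ≤ K)
    (hη : ∀ i, MeanAbsLe P (fun ω => ε i ω ^ 2 - σ ^ 2) K) {n : ℕ} (hn : 2 ≤ n) :
    MeanAbsLe P (fun ω => sampleVariance (fun i => ε i ω) n - σ ^ 2 -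
        (n : ℝ)⁻¹ * ∑ i ∈ Finset.range n, (ε i ω ^ 2 - σ ^ 2))
      (2 * (K + 2 * σ ^ 2) / n) := by
  have hn2 : (2 : ℝ) ≤ n := by exact_mod_cast hn
  have hn0 : (0 : ℝ) < n := by linarith
  have hT : MeanAbsLe P (fun ω => ∑ i ∈ Finset.range n, (ε i ω ^ 2 - σ ^ 2)) (n * K) := by
    simpa using MeanAbsLe.sum (Finset.range n) fun i _ => hη i
  have hS : MeanAbsLe P (fun ω => (∑ i ∈ Finset.range n, 1 * ε i ω) ^ 2) (n * σ ^ 2) := by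
    refine ⟨(memLp_finsetSum _ fun i _ => (hmem i).const_mul 1).integrable_sq, ?_⟩
    simp only [abs_sq]
    rw [integral_sq_sum_of_orthogonal (Finset.range n) ε (fun _ => 1) (fun i _ => hmem i)]
    · simp [hvar]
    · intro i _ j _ hij
      rw [(hindep.indepFun hij).integral_fun_mul_eq_mul_integral (hmem i).aestronglyMeasurable
        (hmem j).aestronglyMeasurable, hmean, zero_mul]
  simp only [sampleVariance_sub_eq _ _ hn]
  refine (((hT.const_mul (n : ℝ)⁻¹).add ((MeanAbsLe.const (le_abs_self |σ ^ 2|)).sub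
    (hS.const_mul (n : ℝ)⁻¹))).const_mul ((n : ℝ) - 1)⁻¹).mono ?_
  rw [abs_of_pos (by rw [inv_pos]; linarith : 0 < ((n : ℝ) - 1)⁻¹),
    abs_of_pos (by positivity : 0 < (n : ℝ)⁻¹), abs_abs, abs_of_nonneg (sq_nonneg σ)]
  have h1 : ((n : ℝ) - 1)⁻¹ ≤ 2 / n := by
    rw [inv_le_comm₀ (by linarith) (by positivity), inv_div]; linarith
  calc ((n : ℝ) - 1)⁻¹ * ((n : ℝ)⁻¹ * (n * K) + (σ ^ 2 + (n : ℝ)⁻¹ * (n * σ ^ 2)))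
      ≤ 2 / n * ((n : ℝ)⁻¹ * (n * K) + (σ ^ 2 + (n : ℝ)⁻¹ * (n * σ ^ 2))) := by gcongr
    _ = _ := by field_simp; ring

lemma tendstoInDistribution_sampleVariance [IsProbabilityMeasure P]
    {ε : ℕ → Ω → ℝ} (hindep : iIndepFun ε P) (hmem : ∀ i, MemLp (ε i) 2 P)
    (hmean : ∀ i, ∫ ω, ε i ω ∂P = 0) {σ : ℝ}
    (hvar : ∀ i, ∫ ω, ε i ω ^ 2 ∂P = σ ^ 2) {K : ℝ} (hK : 0 ≤ K)
    (hη : ∀ i, MeanAbsLe P (fun ω => ε i ω ^ 2 - σ ^ 2) K)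
    {μ : Measure ℝ} [IsProbabilityMeasure μ]
    (hlim : TendstoInDistribution
      (fun (n : ℕ) ω => (√(n : ℝ))⁻¹ * ∑ i ∈ Finset.range n, (ε i ω ^ 2 - σ ^ 2))
      atTop (id : ℝ → ℝ) (fun _ => P) μ) :
    TendstoInDistribution
      (fun (n : ℕ) ω => √(n : ℝ) * (sampleVariance (fun i => ε i ω) n - σ ^ 2))
      atTop (id : ℝ → ℝ) (fun _ => P) μ := by
  have hmeas : ∀ i, AEMeasurable (ε i) P := fun i => (hmem i).aestronglyMeasurable.aemeasurable
  refine tendstoInDistribution_sqrt_mul_sub hlim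
    (fun n => aemeasurable_sampleVariance hmeas n) ?_
    ((eventually_ge_atTop 2).mono fun n h2 =>
      meanAbsLe_sampleVariance_sub hindep hmem hmean hvar hK hη h2)
  have h1 : Tendsto (fun n : ℕ => 2 * (K + 2 * σ ^ 2) / √(n : ℝ)) atTop (𝓝 0) :=
    tendsto_const_nhds.div_atTop (Real.tendsto_sqrt_atTop.comp tendsto_natCast_atTop_atTop)
  refine h1.congr fun n => ?_
  rw [div_eq_mul_inv, ← Real.sqrt_div_self]
  ring

end LagRegression

theorem theorem2 {Ω : Type*} [MeasurableSpace Ω] (P : Measure Ω) [IsProbabilityMeasure P]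
    (g : ℝ → ℝ) (hg : LagRegression.HasBoundedSecondDeriv g)
    (ε : ℕ → Ω → ℝ) (hindep : iIndepFun ε P)
    (hident : ∀ i, IdentDistrib (ε i) (ε 0) P P)
    (hmean : ∫ ω, ε 0 ω ∂P = 0)
    (σ : ℝ) (hσ : 0 < σ) (hvar : ∫ ω, ε 0 ω ^ 2 ∂P = σ ^ 2)
    (hsix : Integrable (fun ω => ε 0 ω ^ 6) P)
    (r : ℝ) (hr0 : 0 < r) (hr : r < 1 / 2)
    (m : ℕ → ℕ) (hm : Tendsto (fun n : ℕ => (m n : ℝ) / (n : ℝ) ^ r) atTop (𝓝 1)) :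
    TendstoInDistribution
      (fun (n : ℕ) (ω : Ω) => √(n : ℝ) *
        (LagRegression.lsEstimator (LagRegression.obs g (fun i => ε i ω) n) n (m n) - σ ^ 2))
      atTop (id : ℝ → ℝ) (fun _ => P)
      (gaussianReal 0 (Real.toNNReal ((LagRegression.gamma4 P (ε 0) σ - 1) * σ ^ 4))) ∧
    TendstoInDistribution
      (fun (n : ℕ) (ω : Ω) => √(n : ℝ) *
        (LagRegression.sampleVariance (fun i => ε i ω) n - σ ^ 2))
      atTop (id : ℝ → ℝ) (fun _ => P)
      (gaussianReal 0 (Real.toNNReal ((LagRegression.gamma4 P (ε 0) σ - 1) * σ ^ 4))) := by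
  obtain ⟨L, hL, hgL⟩ := hg.exists_lipschitz
  have h6 : MemLp (ε 0) 6 P := by
    rw [← integrable_norm_rpow_iff (hident 0).aemeasurable_fst.aestronglyMeasurable
      (by norm_num) (by norm_num)]
    refine hsix.congr (ae_of_all _ fun ω => ?_)
    have h : ‖ε 0 ω‖ ^ (6 : ℝ) = ‖ε 0 ω‖ ^ (6 : ℕ) := by exact_mod_cast Real.rpow_natCast _ 6
    change ε 0 ω ^ 6 = ‖ε 0 ω‖ ^ (6 : ENNReal).toReal
    rw [ENNReal.toReal_ofNat, h, Real.norm_eq_abs, Even.pow_abs (by decide)]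
  have h4 : ∀ i, MemLp (ε i) 4 P := fun i =>
    (hident i).memLp_iff.2 (h6.mono_exponent (by norm_num))
  have h2 : ∀ i, MemLp (ε i) 2 P := fun i => (h4 i).mono_exponent (by norm_num)
  have hmean' : ∀ i, ∫ ω, ε i ω ∂P = 0 := fun i => (hident i).integral_eq.trans hmean
  have hvar' : ∀ i, ∫ ω, ε i ω ^ 2 ∂P = σ ^ 2 := fun i =>
    ((hident i).comp (u := fun x => x ^ 2) (by fun_prop)).integral_eq.trans hvar
  have hη : ∀ i, LagRegression.MeanAbsLe P (fun ω => ε i ω ^ 2 - σ ^ 2) (2 * σ ^ 2) := fun i => by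
    have h1 : LagRegression.MeanAbsLe P (fun ω => ε i ω ^ 2) (σ ^ 2) :=
      ⟨(h2 i).integrable_sq, by simp only [abs_sq]; exact (hvar' i).le⟩
    exact (h1.sub (.const (abs_of_nonneg (sq_nonneg σ)).le)).mono (by linarith)
  have hlim := LagRegression.tendstoInDistribution_sum_sq_sub hindep hident (h4 0) hσ hvar
  exact ⟨LagRegression.tendstoInDistribution_lsEstimator hL hgL hindep h4 hmean' hσ hvar'
      (by positivity) hη hr0 hr hm hlim,
    LagRegression.tendstoInDistribution_sampleVariance hindep h2 hmean' hvar' (by positivity)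
      hη hlim⟩
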